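/- All graphs are finite and simple. For an integer $t\ge 0$, a $t$-tree is a graph obtained by starting with a $t$-clique and iteratively adding vertices whose neighborhood in the current graph is a $t$-clique; the treewidth of a graph $G$ is the least $t$ such that $G$ is isomorphic to a subgraph of a $t$-tree. A fractional coloring of $G$ assigns to each vertex $v$ a Lebesgue measurable set $\phi(v)\subseteq\mathbb R$ of measure $1$ so that $\phi(u)\cap\phi(v)=\emptyset$ for every edge $uv$, and the fractional chromatic number $\chi_f(G)$ is the infimum of the measure of $\bigcup_{v\in V(G)}\phi(v)$ over all fractional colorings $\phi$ of $G$. For integers $t\ge 0$ and $\omega\ge 1$, let $f(t,\omega)$ be the supremum of $\chi_f(G)$ over all graphs $G$ of treewidth exactly $t$ and clique number at most $\omega$. **Theorem.** Let $t$ and $\omega\ge 2$ be integers with $\frac{t+1}{2}\le\omega\le t$. Then $f(t,\omega)$ is finite and $$f(t,\omega)\ \ge\ t+1-\sum_{i=1}^{t-\omega+1}\frac{1}{f(t-2i+1,\ \omega-i+1)}.$$ -/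

import Mathlib

open scoped ENNReal

namespace SimpleGraph

/-- `H.BuildsTree t S`: the subgraph of `H` induced by the finite vertex set `S` is a `t`-tree, that
is, it arises from a `t`-clique by iteratively adding a vertex whose neighbourhood in the graph
built so far is a `t`-clique. -/
inductive BuildsTree {V : Type*} (H : SimpleGraph V) (t : ℕ) : Finset V → Prop
  | base (K : Finset V) (hK : H.IsNClique t K) : BuildsTree H t K
  | add (S : Finset V) (hS : BuildsTree H t S) (v : V) (hv : v ∉ S) (K : Finset V)
      (hKS : K ⊆ S) (hK : H.IsNClique t K) (hN : ∀ u ∈ S, H.Adj v u ↔ u ∈ K) :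
      BuildsTree H t (S.cons v hv)

/-- `H` is a (finite) `t`-tree. -/
def IsTTree {V : Type*} (H : SimpleGraph V) (t : ℕ) : Prop :=
  ∃ S : Finset V, H.BuildsTree t S ∧ ∀ v, v ∈ S

/-- `G` is a partial `t`-tree: it is isomorphic to a (not necessarily induced) subgraph of a
`t`-tree. -/
def IsPartialTTree {V : Type*} (G : SimpleGraph V) (t : ℕ) : Prop :=
  ∃ (m : ℕ) (H : SimpleGraph (Fin m)), H.IsTTree t ∧ G ⊑ H

/-- The treewidth of a finite graph: the least `t` for which it is a partial `t`-tree. -/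
noncomputable def treewidth {V : Type*} (G : SimpleGraph V) : ℕ :=
  sInf {t | G.IsPartialTTree t}

/-- A fractional coloring assigns to every vertex a Lebesgue measurable set of reals of measure `1`,
with disjoint sets at adjacent vertices. -/
structure IsFractionalColoring {V : Type*} (G : SimpleGraph V) (φ : V → Set ℝ) : Prop where
  nullMeasurableSet : ∀ v, MeasureTheory.NullMeasurableSet (φ v) MeasureTheory.volume
  volume_eq_one : ∀ v, MeasureTheory.volume (φ v) = 1
  disjoint_of_adj : ∀ u v, G.Adj u v → Disjoint (φ u) (φ v)

/-- The fractional chromatic number `χ_f(G)`, as an extended nonnegative real. -/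
noncomputable def fractionalChromaticNumber {V : Type*} (G : SimpleGraph V) : ℝ≥0∞ :=
  ⨅ (φ : V → Set ℝ) (_ : G.IsFractionalColoring φ), MeasureTheory.volume (⋃ v, φ v)

/-- `f(t, ω)`: the supremum of `χ_f(G)` over all finite graphs `G` of treewidth (exactly) `t` and
clique number at most `ω`. Up to isomorphism the vertex set is `Fin n`. -/
noncomputable def maxFractionalChromaticNumber (t ω : ℕ) : ℝ≥0∞ :=
  ⨆ (n : ℕ) (G : SimpleGraph (Fin n)) (_ : G.treewidth = t) (_ : G.cliqueNum ≤ ω),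
    G.fractionalChromaticNumber

end SimpleGraph

/-! The bound comes from a gluing step that raises the treewidth by two and the clique number by
one. Let `G` have treewidth `t + 1` and clique number at most `ω + 1`, and let `X` have treewidth at
most `t` and clique number at most `ω`. Take an apex not adjacent to `G`, and for each vertex `w` of
`G` a copy of `X` joined to `w` and to the apex (`coneGluing`). The result has treewidth at most `t
+ 2` and clique number at most `ω + 1`.

In a fractional coloring `φ` of it, let `A` be the color set of the apex and let `w` minimize the
measure `m` of `φ w ∩ A`. Traces on `A`, cut down to measure `m` and scaled by `1 / m`, color `G`
within measure `1 / m`, so `m ≤ 1 / χ_f(G)`. The copy of `X` at `w` avoids `φ w ∪ A`, of measure `2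
- m`. Hence `χ_f(X) + 2 ≤ χ_f(coneGluing) + 1 / χ_f(G)`
(`fractionalChromaticNumber_add_two_le_coneGluing`).

Taking suprema and iterating `t - ω + 1` times from a complete graph yields the sum
(`add_one_le_maxFractionalChromaticNumberOfLE_add_sum`). The induction bounds the treewidth only
from above; a disjoint `K_{t,t}` makes it exact, which is where `2 ≤ ω` enters. Finiteness is greedy
coloring with `t + 1` colors. -/

namespace SimpleGraph

/-! ### Treewidth through elimination rankings -/

section Width

variable {V W : Type*}

/-- A ranking of the vertices, separating adjacent ones, in which the neighbours of lower rank of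
any vertex form a clique of at most `t` vertices. -/
structure IsEliminationRank (H : SimpleGraph V) (t : ℕ) (r : V → ℕ) : Prop where
  ne_of_adj : ∀ u v, H.Adj u v → r u ≠ r v
  isClique : ∀ v, H.IsClique {u | H.Adj v u ∧ r u < r v}
  encard_le : ∀ v, {u | H.Adj v u ∧ r u < r v}.encard ≤ t

/-- `G` is contained in a graph on the same vertices with an elimination ranking of width `t`. -/
def HasWidthAtMost (G : SimpleGraph V) (t : ℕ) : Prop :=
  ∃ H : SimpleGraph V, G ≤ H ∧ ∃ r, H.IsEliminationRank t r

theorem IsEliminationRank.comap {H : SimpleGraph W} {t : ℕ} {r : W → ℕ}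
    (hr : H.IsEliminationRank t r) (f : V ↪ W) : (H.comap f).IsEliminationRank t (r ∘ f) where
  ne_of_adj u v h := hr.ne_of_adj _ _ h
  isClique v a ha b hb hab := hr.isClique (f v) ha hb (f.injective.ne hab)
  encard_le v := by
    rw [← f.injective.encard_image]
    refine (Set.encard_le_encard ?_).trans (hr.encard_le (f v))
    rintro _ ⟨u, hu, rfl⟩
    exact hu

theorem HasWidthAtMost.of_isContained {G : SimpleGraph V} {G' : SimpleGraph W} {t : ℕ}
    (hG : G'.HasWidthAtMost t) (h : G ⊑ G') : G.HasWidthAtMost t := by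
  obtain ⟨H, hH, r, hr⟩ := hG
  obtain ⟨f, hf⟩ := isContained_iff_exists_le_comap.1 h
  exact ⟨H.comap f, hf.trans (fun _ _ hab => hH hab), _, hr.comap f⟩

theorem BuildsTree.exists_rank [Countable V] {H : SimpleGraph V} {t : ℕ} {S : Finset V}
    (h : H.BuildsTree t S) :
    ∃ r : V → ℕ, (∀ u ∈ S, ∀ v ∈ S, H.Adj u v → r u ≠ r v) ∧
      ∀ v ∈ S, H.IsClique {u | u ∈ S ∧ H.Adj v u ∧ r u < r v} ∧
        {u | u ∈ S ∧ H.Adj v u ∧ r u < r v}.encard ≤ t := by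
  classical
  induction h with
  | base K hK =>
    -- Inside a clique of `t` vertices any injective ranking works.
    obtain ⟨r, hr⟩ := exists_injective_nat V
    refine ⟨r, fun u _ v _ h => hr.ne h.ne, fun v _ => ⟨hK.isClique.subset fun u hu => hu.1, ?_⟩⟩
    refine (Set.encard_le_encard (t := (K : Set V)) fun u hu => hu.1).trans ?_
    rw [Set.encard_coe_eq_coe_finsetCard, hK.card_eq]
  | add S hS v hv K hKS hK hN ih =>
    obtain ⟨r, h1, h2⟩ := ih
    have hlt : ∀ u ∈ S, r u < S.sup r + 1 := fun u hu => Nat.lt_succ_of_le (Finset.le_sup hu)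
    have hne : ∀ u ∈ S, u ≠ v := fun u hu h => hv (h ▸ hu)
    refine ⟨Function.update r v (S.sup r + 1), ?_, ?_⟩
    · intro a ha b hb hab
      rcases Finset.mem_cons.1 ha with rfl | ha' <;> rcases Finset.mem_cons.1 hb with rfl | hb'
      · exact absurd hab (H.loopless.irrefl _)
      · simpa [hne b hb'] using (hlt b hb').ne'
      · simpa [hne a ha'] using (hlt a ha').ne
      · simpa [hne a ha', hne b hb'] using h1 a ha' b hb' hab
    · intro a ha
      rcases Finset.mem_cons.1 ha with rfl | ha'
      · have hsub : {u | u ∈ S.cons a hv ∧ H.Adj a u ∧ Function.update r a (S.sup r + 1) u <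
            Function.update r a (S.sup r + 1) a} ⊆ (K : Set V) := by
          rintro u ⟨hu, hau, -⟩
          rcases Finset.mem_cons.1 hu with rfl | hu
          · exact absurd hau (H.loopless.irrefl _)
          · exact (hN u hu).1 hau
        refine ⟨hK.isClique.subset hsub, (Set.encard_le_encard hsub).trans ?_⟩
        rw [Set.encard_coe_eq_coe_finsetCard, hK.card_eq]
      · have hsub : {u | u ∈ S.cons v hv ∧ H.Adj a u ∧ Function.update r v (S.sup r + 1) u <
            Function.update r v (S.sup r + 1) a} ⊆ {u | u ∈ S ∧ H.Adj a u ∧ r u < r a} := by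
          rintro u ⟨hu, hau, hlt'⟩
          rcases Finset.mem_cons.1 hu with rfl | hu
          · have := hlt a ha'
            simp only [Function.update_self, Function.update_of_ne (hne a ha')] at hlt'
            omega
          · exact ⟨hu, hau, by simpa [hne a ha', hne u hu] using hlt'⟩
        exact ⟨(h2 a ha').1.subset hsub, (Set.encard_le_encard hsub).trans (h2 a ha').2⟩

theorem IsPartialTTree.hasWidthAtMost {G : SimpleGraph V} {t : ℕ} (h : G.IsPartialTTree t) :
    G.HasWidthAtMost t := by
  obtain ⟨m, H, ⟨S, hS, hu⟩, hG⟩ := h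
  obtain ⟨r, h1, h2⟩ := hS.exists_rank
  simp only [hu, true_and, true_imp_iff] at h1 h2
  exact HasWidthAtMost.of_isContained
    ⟨H, le_rfl, r, h1, fun v => (h2 v).1, fun v => (h2 v).2⟩ hG

theorem BuildsTree.congr {H H' : SimpleGraph V} {t : ℕ} {S : Finset V} (h : H.BuildsTree t S)
    (hH : ∀ u ∈ S, ∀ v ∈ S, H.Adj u v ↔ H'.Adj u v) : H'.BuildsTree t S := by
  have key : ∀ K ⊆ S, H.IsNClique t K → H'.IsNClique t K := fun K hKS hK =>
    ⟨fun a ha b hb hab => (hH a (hKS ha) b (hKS hb)).1 (hK.isClique ha hb hab), hK.card_eq⟩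
  induction h with
  | base K hK => exact .base K (key K subset_rfl hK)
  | add S hS v hv K hKS hK hN ih =>
    have hsub : S ⊆ S.cons v hv := Finset.subset_cons hv
    refine .add S (ih (fun a ha b hb => hH a (hsub ha) b (hsub hb))
      fun K hK => key K (hK.trans hsub)) v hv K hKS (key K (hKS.trans hsub) hK) fun u hu => ?_
    rw [← hN u hu, hH v (Finset.mem_cons_self v S) u (hsub hu)]

/-- If `Q` contains the last vertex `v`, the rest of `Q` lies in the clique `K` to which `v` was
attached; enlarge it to `t - 1` vertices of `K` and add `v`. -/
theorem BuildsTree.exists_isNClique_superset {H : SimpleGraph V} {t : ℕ} {S : Finset V}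
    (h : H.BuildsTree t S) {Q : Finset V} (hQS : Q ⊆ S) (hQ : H.IsClique Q) (hQt : Q.card ≤ t) :
    ∃ K ⊆ S, Q ⊆ K ∧ H.IsNClique t K := by
  classical
  induction h generalizing Q with
  | base K hK => exact ⟨K, subset_rfl, hQS, hK⟩
  | add S hS v hv K hKS hK hN ih =>
    by_cases hvQ : v ∈ Q
    · have hsub : Q.erase v ⊆ K := by
        intro u hu
        have huQ := Finset.mem_of_mem_erase hu
        have huv := Finset.ne_of_mem_erase hu
        have huS : u ∈ S := (Finset.mem_cons.1 (hQS huQ)).resolve_left huv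
        exact (hN u huS).1 (hQ hvQ huQ huv.symm)
      have hcard := Finset.card_erase_add_one hvQ
      obtain ⟨L, hL1, hL2, hL3⟩ := Finset.exists_subsuperset_card_eq hsub
        (n := t - 1) (by omega) (by rw [hK.card_eq]; omega)
      have hvL : v ∉ L := fun h => hv (hKS (hL2 h))
      refine ⟨L.cons v hvL, Finset.cons_subset_cons.2 (hL2.trans hKS), ?_, ?_, ?_⟩
      · intro u hu
        by_cases huv : u = v
        · simp [huv]
        · exact Finset.mem_cons.2 (.inr (hL1 (Finset.mem_erase.2 ⟨huv, hu⟩)))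
      · rw [Finset.coe_cons, isClique_insert]
        exact ⟨hK.isClique.subset (by exact_mod_cast hL2),
          fun u hu _ => (hN u (hKS (hL2 hu))).2 (hL2 hu)⟩
      · rw [Finset.card_cons, hL3]
        omega
    · obtain ⟨L, hL, hQL, hLc⟩ := ih (Q := Q) (fun u hu => (Finset.mem_cons.1 (hQS hu)).resolve_left
        fun h => hvQ (h ▸ hu)) hQ hQt
      exact ⟨L, hL.trans (Finset.subset_cons hv), hQL, hLc⟩

/-- The `t` auxiliary vertices form the starting clique, so that even small graphs embed. Vertices
are added by increasing rank; the earlier neighbors of each form a clique of size at most `t`, which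
extends to a `t`-clique serving as its neighborhood. -/
theorem IsEliminationRank.exists_buildsTree {H : SimpleGraph V} {t : ℕ} {r : V → ℕ}
    (hr : H.IsEliminationRank t r) (S : Finset V) :
    ∃ T : SimpleGraph (Fin t ⊕ V), T.BuildsTree t ((Finset.univ : Finset (Fin t)).disjSum S) ∧
      ∀ u ∈ S, ∀ v ∈ S, H.Adj u v → T.Adj (.inr u) (.inr v) := by
  classical
  induction S using Finset.induction_on_max_value r with
  | empty => exact ⟨⊤, .base _ ⟨fun a _ b _ hab => hab, by simp⟩, by simp⟩
  | insert a S ha hmax ih =>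
    obtain ⟨T, hT, hHT⟩ := ih
    set N := S.filter (H.Adj a) with hN
    have hNsub : (N : Set V) ⊆ {u | H.Adj a u ∧ r u < r a} := by
      intro u hu
      obtain ⟨huS, hau⟩ := Finset.mem_filter.1 hu
      exact ⟨hau, lt_of_le_of_ne (hmax u huS) (hr.ne_of_adj _ _ hau).symm⟩
    have hNcard : N.card ≤ t := by
      have := (Set.encard_le_encard hNsub).trans (hr.encard_le a)
      rw [Set.encard_coe_eq_coe_finsetCard] at this
      exact_mod_cast this
    obtain ⟨K, hKS, hNK, hK⟩ := hT.exists_isNClique_superset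
      (Q := N.map .inr) (by intro x; simp +contextual [hN, eq_comm]) (by
        rintro _ hu _ hv huv
        obtain ⟨u, hu', rfl⟩ := Finset.mem_map.1 (Finset.mem_coe.1 hu)
        obtain ⟨v, hv', rfl⟩ := Finset.mem_map.1 (Finset.mem_coe.1 hv)
        exact hHT u (Finset.mem_filter.1 hu').1 v (Finset.mem_filter.1 hv').1
          (hr.isClique a (hNsub hu') (hNsub hv') fun h => huv (h ▸ rfl))) (by simpa using hNcard)
    have haS : (.inr a : Fin t ⊕ V) ∉ (Finset.univ : Finset (Fin t)).disjSum S := by simpa using ha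
    have haK : (.inr a : Fin t ⊕ V) ∉ K := fun h => haS (hKS h)
    let T' : SimpleGraph (Fin t ⊕ V) :=
      { Adj := fun p q => (p ≠ .inr a ∧ q ≠ .inr a ∧ T.Adj p q) ∨ (p = .inr a ∧ q ∈ K) ∨
          (q = .inr a ∧ p ∈ K)
        symm := ⟨fun p q h => by
          rcases h with ⟨h1, h2, h3⟩ | h | h
          · exact .inl ⟨h2, h1, h3.symm⟩
          · exact .inr (.inr h)
          · exact .inr (.inl h)⟩
        loopless := ⟨fun p h => by
          rcases h with ⟨-, -, h⟩ | ⟨rfl, h⟩ | ⟨rfl, h⟩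
          · exact h.ne rfl
          · exact haK h
          · exact haK h⟩ }
    have hTT' : ∀ p ∈ (Finset.univ : Finset (Fin t)).disjSum S,
        ∀ q ∈ (Finset.univ : Finset (Fin t)).disjSum S, T.Adj p q ↔ T'.Adj p q := by
      intro p hp q hq
      have hpa : p ≠ .inr a := fun h => haS (h ▸ hp)
      have hqa : q ≠ .inr a := fun h => haS (h ▸ hq)
      simp [T', hpa, hqa]
    refine ⟨T', ?_, ?_⟩
    · have hS : (Finset.univ : Finset (Fin t)).disjSum (insert a S) =
          ((Finset.univ : Finset (Fin t)).disjSum S).cons (.inr a) haS := by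
        ext (x | x) <;> simp
      rw [hS]
      refine .add _ (hT.congr hTT') _ haS K hKS
        ⟨fun p hp q hq hpq => (hTT' p (hKS hp) q (hKS hq)).1 (hK.isClique hp hq hpq), hK.card_eq⟩
        fun u hu => ?_
      have hua : u ≠ .inr a := fun h => haS (h ▸ hu)
      simp [T', hua]
    · intro u hu v hv huv
      have hmem : ∀ w ∈ S, H.Adj a w → (.inr w : Fin t ⊕ V) ∈ K := fun w hw haw =>
        hNK (Finset.mem_map.2 ⟨w, Finset.mem_filter.2 ⟨hw, haw⟩, rfl⟩)
      have hadj : ∀ w ∈ S, (.inr w : Fin t ⊕ V) ∈ (Finset.univ : Finset (Fin t)).disjSum S := by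
        simp
      rcases Finset.mem_insert.1 hu with rfl | hu' <;> rcases Finset.mem_insert.1 hv with rfl | hv'
      · exact absurd huv (H.loopless.irrefl _)
      · exact .inr (.inl ⟨rfl, hmem v hv' huv⟩)
      · exact .inr (.inr ⟨rfl, hmem u hu' huv.symm⟩)
      · exact (hTT' _ (hadj u hu') _ (hadj v hv')).1 (hHT u hu' v hv' huv)

theorem BuildsTree.map {H : SimpleGraph V} {t : ℕ} {S : Finset V} (h : H.BuildsTree t S)
    {H' : SimpleGraph W} (e : H ≃g H') : H'.BuildsTree t (S.map e.toEquiv.toEmbedding) := by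
  have key : ∀ K, H.IsNClique t K → H'.IsNClique t (K.map e.toEquiv.toEmbedding) := by
    refine fun K hK => ⟨?_, by simpa using hK.card_eq⟩
    rintro _ ha _ hb hab
    obtain ⟨a, ha', rfl⟩ := Finset.mem_map.1 (Finset.mem_coe.1 ha)
    obtain ⟨b, hb', rfl⟩ := Finset.mem_map.1 (Finset.mem_coe.1 hb)
    exact e.map_rel_iff.2 (hK.isClique ha' hb' fun h => hab (h ▸ rfl))
  induction h with
  | base K hK => exact .base _ (key K hK)
  | add S hS v hv K hKS hK hN ih =>
    rw [Finset.map_cons]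
    refine .add _ ih _ _ _ (Finset.map_subset_map.2 hKS) (key K hK) fun u hu => ?_
    obtain ⟨u, hu', rfl⟩ := Finset.mem_map.1 hu
    rw [Finset.mem_map', ← hN u hu']
    exact e.map_rel_iff

theorem HasWidthAtMost.isPartialTTree [Finite V] {G : SimpleGraph V} {t : ℕ}
    (h : G.HasWidthAtMost t) : G.IsPartialTTree t := by
  classical
  cases nonempty_fintype V
  obtain ⟨H, hGH, r, hr⟩ := h
  obtain ⟨T, hT, hHT⟩ := hr.exists_buildsTree Finset.univ
  refine ⟨_, T.overFin rfl, ⟨_, hT.map (T.overFinIso rfl), fun v => ?_⟩, ?_⟩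
  · exact Finset.mem_map.2 ⟨(T.overFinIso rfl).symm v, by
      cases (T.overFinIso rfl).symm v <;> simp, (T.overFinIso rfl).apply_symm_apply v⟩
  · refine IsContained.trans (isContained_iff_exists_le_comap.2 ⟨.inr, fun u v huv => ?_⟩)
      (T.overFinIso rfl).isContained
    exact hHT u (Finset.mem_univ u) v (Finset.mem_univ v) (hGH huv)

theorem exists_hasWidthAtMost [Finite V] (G : SimpleGraph V) : ∃ t, G.HasWidthAtMost t := by
  obtain ⟨n, ⟨e⟩⟩ := Finite.exists_equiv_fin V
  refine ⟨n, ⊤, le_top, fun v => e v, fun u v h => ?_, fun v a _ b _ hab => hab, fun v => ?_⟩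
  · exact fun h' => h (e.injective (Fin.ext h'))
  · refine (Set.encard_le_encard (Set.subset_univ _)).trans ?_
    rw [Set.encard_univ, ENat.card_congr e]
    simp

theorem hasWidthAtMost_treewidth [Finite V] (G : SimpleGraph V) :
    G.HasWidthAtMost G.treewidth := by
  obtain ⟨t, ht⟩ := G.exists_hasWidthAtMost
  exact IsPartialTTree.hasWidthAtMost (Nat.sInf_mem (s := {t | G.IsPartialTTree t})
    ⟨t, ht.isPartialTTree⟩)

theorem treewidth_eq_of_isContained {G : SimpleGraph V} [Finite V] {t : ℕ}
    (hG : G.HasWidthAtMost t) {B : SimpleGraph W} (hB : B ⊑ G)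
    (h : ∀ s, B.HasWidthAtMost s → t ≤ s) : G.treewidth = t :=
  le_antisymm (Nat.sInf_le hG.isPartialTTree) (h _ (G.hasWidthAtMost_treewidth.of_isContained hB))

/-- Greedy coloring by increasing rank: each vertex has at most `t` earlier neighbors. -/
theorem HasWidthAtMost.colorable [Finite V] {G : SimpleGraph V} {t : ℕ}
    (h : G.HasWidthAtMost t) : G.Colorable (t + 1) := by
  classical
  cases nonempty_fintype V
  obtain ⟨H, hGH, r, hr⟩ := h
  suffices ∀ S : Finset V, ∃ c : V → Fin (t + 1), ∀ u ∈ S, ∀ v ∈ S, H.Adj u v → c u ≠ c v by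
    obtain ⟨c, hc⟩ := this Finset.univ
    exact ⟨Coloring.mk c fun {u v} huv => hc u (Finset.mem_univ u) v (Finset.mem_univ v) (hGH huv)⟩
  intro S
  induction S using Finset.induction_on_max_value r with
  | empty => exact ⟨fun _ => 0, by simp⟩
  | insert a S ha hmax ih =>
    obtain ⟨c, hc⟩ := ih
    have hNsub : (S.filter (H.Adj a) : Set V) ⊆ {u | H.Adj a u ∧ r u < r a} := by
      intro u hu
      obtain ⟨huS, hau⟩ := Finset.mem_filter.1 hu
      exact ⟨hau, lt_of_le_of_ne (hmax u huS) (hr.ne_of_adj _ _ hau).symm⟩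
    have hNcard : (S.filter (H.Adj a)).card ≤ t := by
      have := (Set.encard_le_encard hNsub).trans (hr.encard_le a)
      rw [Set.encard_coe_eq_coe_finsetCard] at this
      exact_mod_cast this
    obtain ⟨k, hk⟩ : ∃ k, k ∉ (S.filter (H.Adj a)).image c := by
      by_contra! hcon
      have := Finset.card_le_card (fun k _ => hcon k : Finset.univ ⊆ (S.filter (H.Adj a)).image c)
      have := Finset.card_image_le (s := S.filter (H.Adj a)) (f := c)
      simp only [Finset.card_univ, Fintype.card_fin] at *
      omega
    have hk' : ∀ w ∈ S, H.Adj a w → c w ≠ k := fun w hw haw h =>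
      hk (Finset.mem_image.2 ⟨w, Finset.mem_filter.2 ⟨hw, haw⟩, h⟩)
    have hne : ∀ u ∈ S, u ≠ a := fun u hu h => ha (h ▸ hu)
    refine ⟨Function.update c a k, fun u hu v hv huv => ?_⟩
    rcases Finset.mem_insert.1 hu with rfl | hu' <;> rcases Finset.mem_insert.1 hv with rfl | hv'
    · exact absurd huv (H.loopless.irrefl _)
    · simpa [hne v hv'] using (hk' v hv' huv).symm
    · simpa [hne u hu'] using hk' u hu' huv.symm
    · simpa [hne u hu', hne v hv'] using hc u hu' v hv' huv

end Width

/-! ### Fractional colorings and rescaling of traces -/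

section FractionalColoring

open MeasureTheory
open scoped Pointwise

variable {V W : Type*}

theorem IsFractionalColoring.comp {G : SimpleGraph V} {G' : SimpleGraph W} {φ : W → Set ℝ}
    (hφ : G'.IsFractionalColoring φ) (f : G →g G') : G.IsFractionalColoring (φ ∘ f) where
  nullMeasurableSet v := hφ.nullMeasurableSet (f v)
  volume_eq_one v := hφ.volume_eq_one (f v)
  disjoint_of_adj _ _ h := hφ.disjoint_of_adj _ _ (f.map_adj h)

theorem fractionalChromaticNumber_le {G : SimpleGraph V} {φ : V → Set ℝ}
    (hφ : G.IsFractionalColoring φ) : G.fractionalChromaticNumber ≤ volume (⋃ v, φ v) :=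
  iInf₂_le φ hφ

theorem fractionalChromaticNumber_mono {G : SimpleGraph V} {G' : SimpleGraph W} (f : G →g G') :
    G.fractionalChromaticNumber ≤ G'.fractionalChromaticNumber :=
  le_iInf₂ fun _ hφ => (fractionalChromaticNumber_le (hφ.comp f)).trans
    (measure_mono (Set.iUnion_subset fun v => Set.subset_iUnion_of_subset (f v) subset_rfl))

theorem Coloring.fractionalChromaticNumber_le {G : SimpleGraph V} {n : ℕ}
    (c : G.Coloring (Fin n)) : G.fractionalChromaticNumber ≤ n := by
  have hφ : G.IsFractionalColoring fun v => Set.Ioc ((c v : ℕ) : ℝ) ((c v : ℕ) + 1) := by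
    refine ⟨fun v => measurableSet_Ioc.nullMeasurableSet, fun v => by simp, fun u v huv => ?_⟩
    have hne : (c u : ℕ) ≠ c v := fun h => c.valid huv (Fin.ext h)
    rw [Set.Ioc_disjoint_Ioc]
    rcases hne.lt_or_gt with h | h
    · exact (min_le_left _ _).trans (le_max_of_le_right (by exact_mod_cast h))
    · exact (min_le_right _ _).trans (le_max_of_le_left (by exact_mod_cast h))
  refine (SimpleGraph.fractionalChromaticNumber_le hφ).trans ?_
  refine (measure_mono (t := Set.Ioc (0 : ℝ) n) (Set.iUnion_subset fun v => ?_)).trans (by simp)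
  exact Set.Ioc_subset_Ioc (by positivity) (by exact_mod_cast (c v).2)

theorem natCast_le_fractionalChromaticNumber_top (n : ℕ) :
    (n : ℝ≥0∞) ≤ (⊤ : SimpleGraph (Fin n)).fractionalChromaticNumber := by
  refine le_iInf₂ fun φ hφ => ?_
  rw [measure_iUnion₀ (fun u v huv => (hφ.disjoint_of_adj u v huv).aedisjoint)
    hφ.nullMeasurableSet]
  simp [hφ.volume_eq_one]

/-- A set of reals of finite Lebesgue measure has null measurable subsets of any smaller measure. -/
theorem exists_nullMeasurableSet_subset_volume_eq {A : Set ℝ} (hA : NullMeasurableSet A)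
    (hfin : volume A ≠ ⊤) {m : ℝ≥0∞} (hm : m ≤ volume A) :
    ∃ B ⊆ A, NullMeasurableSet B ∧ volume B = m := by
  rcases hm.eq_or_lt with rfl | hm
  · exact ⟨A, subset_rfl, hA, rfl⟩
  have hlim : Filter.Tendsto (fun n : ℕ => volume (A ∩ Set.Ioc (-(n : ℝ)) n)) Filter.atTop
      (nhds (volume A)) := by
    have hmono : Monotone fun n : ℕ => A ∩ Set.Ioc (-(n : ℝ)) n := fun a b hab =>
      Set.inter_subset_inter_right _ (Set.Ioc_subset_Ioc
        (neg_le_neg (by exact_mod_cast hab)) (by exact_mod_cast hab))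
    have := tendsto_measure_iUnion_atTop (μ := volume) hmono
    rwa [← Set.inter_iUnion, Set.iUnion_eq_univ_iff.2, Set.inter_univ] at this
    intro x
    obtain ⟨n, hn⟩ := exists_nat_gt |x|
    exact ⟨n, (abs_lt.1 hn).1, (abs_lt.1 hn).2.le⟩
  obtain ⟨n, hn⟩ := (hlim.eventually (lt_mem_nhds hm)).exists
  have hne : ∀ x, volume (A ∩ Set.Ioc (-(n : ℝ)) x) ≠ ⊤ := fun x =>
    measure_ne_top_of_subset Set.inter_subset_left hfin
  set g : ℝ → ℝ := fun x => (volume (A ∩ Set.Ioc (-(n : ℝ)) x)).toReal with hg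
  -- Moving the endpoint from `y` to `x` adds measure at most `|x - y|`, so `g` is 1-Lipschitz and
  -- the intermediate value theorem applies.
  have hgc : Continuous g := by
    refine LipschitzWith.continuous (K := 1) (LipschitzWith.of_le_add_mul 1 fun x y => ?_)
    have h1 : volume (A ∩ Set.Ioc (-(n : ℝ)) x) ≤
        volume (A ∩ Set.Ioc (-(n : ℝ)) y) + ENNReal.ofReal (Dist.dist x y) := by
      refine (measure_mono (t := (A ∩ Set.Ioc (-(n : ℝ)) y) ∪ Set.Ioc y x) ?_).trans
        ((measure_union_le _ _).trans (add_le_add le_rfl ?_))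
      · rintro z ⟨hz, h1, h2⟩
        rcases le_or_gt z y with h | h
        · exact .inl ⟨hz, h1, h⟩
        · exact .inr ⟨h, h2⟩
      · rw [Real.volume_Ioc, Real.dist_eq]
        exact ENNReal.ofReal_le_ofReal (le_abs_self _)
    have h2 := ENNReal.toReal_mono (by simp [hne]) h1
    rw [ENNReal.toReal_add (hne y) (by simp), ENNReal.toReal_ofReal dist_nonneg] at h2
    simpa [hg] using h2
  have hmt : m ≠ ⊤ := hm.ne_top
  obtain ⟨x, -, hx⟩ := intermediate_value_Icc (f := g) (a := -(n : ℝ)) (b := n)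
    (by linarith [(Nat.cast_nonneg n : (0 : ℝ) ≤ n)]) hgc.continuousOn
    (show m.toReal ∈ _ from ⟨by simp [hg], ENNReal.toReal_mono (hne _) hn.le⟩)
  exact ⟨_, Set.inter_subset_left, hA.inter measurableSet_Ioc.nullMeasurableSet,
    (ENNReal.toReal_eq_toReal_iff' (hne x) hmt).1 hx⟩

theorem volume_inv_toReal_smul {m : ℝ≥0∞} (hm0 : m ≠ 0) (hmt : m ≠ ⊤) (s : Set ℝ) :
    volume (m.toReal⁻¹ • s) = m⁻¹ * volume s := by
  rw [Measure.addHaar_smul_of_nonneg _ (by positivity), Module.finrank_self, pow_one,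
    ENNReal.ofReal_inv_of_pos (ENNReal.toReal_pos hm0 hmt), ENNReal.ofReal_toReal hmt]

/-- If every color class meets a set `A` of measure `1` in measure at least `m`, then the traces
on `A` can be rescaled to a fractional coloring with colors of total measure at most `m⁻¹`. -/
theorem IsFractionalColoring.le_inv_fractionalChromaticNumber {G : SimpleGraph V} {φ : V → Set ℝ}
    (hφ : G.IsFractionalColoring φ) {A : Set ℝ} (hA : NullMeasurableSet A) (hA1 : volume A = 1)
    {m : ℝ≥0∞} (hmt : m ≠ ⊤) (hm : ∀ v, m ≤ volume (φ v ∩ A)) :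
    m ≤ 1 / G.fractionalChromaticNumber := by
  rcases eq_or_ne m 0 with rfl | hm0
  · simp
  have hr : 0 < m.toReal⁻¹ := inv_pos.2 (ENNReal.toReal_pos hm0 hmt)
  have hscale := fun s => volume_inv_toReal_smul hm0 hmt s
  -- Traces must be cut down to measure exactly `m`, so that scaling by `1 / m` gives measure `1`.
  have hex : ∀ v, ∃ B ⊆ φ v ∩ A, NullMeasurableSet B ∧ volume B = m := fun v =>
    exists_nullMeasurableSet_subset_volume_eq ((hφ.nullMeasurableSet v).inter hA)
      (measure_ne_top_of_subset Set.inter_subset_right (by simp [hA1])) (hm v)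
  choose B hBs hB hBm using hex
  have hψ : G.IsFractionalColoring fun v => m.toReal⁻¹ • B v := by
    refine ⟨fun v => Measure.NullMeasurableSet.const_smul (hB v) _, fun v => ?_, fun u v huv => ?_⟩
    · rw [hscale, hBm, ENNReal.inv_mul_cancel hm0 hmt]
    · have hd : Disjoint (B u) (B v) := (hφ.disjoint_of_adj u v huv).mono
        ((hBs u).trans Set.inter_subset_left) ((hBs v).trans Set.inter_subset_left)
      exact (Set.disjoint_image_iff (smul_right_injective ℝ hr.ne')).2 hd
  have hle : G.fractionalChromaticNumber ≤ m⁻¹ := by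
    refine (SimpleGraph.fractionalChromaticNumber_le hψ).trans ?_
    rw [← Set.smul_set_iUnion, hscale]
    refine (mul_le_mul_right (measure_mono (t := A) (Set.iUnion_subset fun v =>
      (hBs v).trans Set.inter_subset_right)) _).trans ?_
    rw [hA1, mul_one]
  rw [one_div]
  exact ENNReal.le_inv_iff_le_inv.1 hle

end FractionalColoring

/-! ### The gluing construction: width, cliques, fractional chromatic number -/

section ConeGluing

open MeasureTheory

variable {U W : Type*}

/-- The graph obtained from `G` by adding an apex `none` and, for each vertex `w` of `G`, a copy of
`X` completely joined to `w` and to the apex. The apex is adjacent to the vertices of `G` exactly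
when `b` holds. -/
def coneGluing (G : SimpleGraph W) (X : SimpleGraph U) (b : Prop) :
    SimpleGraph (Option W ⊕ W × U) where
  Adj
    | .inl none, .inl none => False
    | .inl none, .inl (some _) => b
    | .inl (some _), .inl none => b
    | .inl (some v), .inl (some w) => G.Adj v w
    | .inl none, .inr _ => True
    | .inr _, .inl none => True
    | .inl (some v), .inr p => v = p.1
    | .inr p, .inl (some v) => v = p.1
    | .inr p, .inr q => p.1 = q.1 ∧ X.Adj p.2 q.2
  symm := ⟨by
    rintro ((_ | v) | p) ((_ | w) | q) h
    · exact h
    · exact h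
    · exact h
    · exact h
    · exact h.symm
    · exact h
    · exact h
    · exact h
    · exact ⟨h.1.symm, h.2.symm⟩⟩
  loopless := ⟨by
    rintro ((_ | v) | p) h
    · exact h
    · exact G.loopless.irrefl _ h
    · exact X.loopless.irrefl _ h.2⟩

theorem coneGluing_mono {G G' : SimpleGraph W} {X X' : SimpleGraph U} (hG : G ≤ G') (hX : X ≤ X')
    (b : Prop) : coneGluing G X b ≤ coneGluing G' X' True := by
  rintro ((_ | v) | p) ((_ | w) | q) h
  · exact h
  · exact trivial
  · exact h
  · exact trivial
  · exact hG h
  · exact h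
  · exact h
  · exact h
  · exact ⟨h.1, hX h.2⟩

/-- The apex comes first, then `G`, then all copies of `X`. The apex is joined to `G` so that lower
neighborhoods are cliques: a vertex of `G` gains the apex, a vertex of a copy gains the apex and its
`w`. -/
theorem IsEliminationRank.coneGluing {G : SimpleGraph W} {X : SimpleGraph U} {t N : ℕ}
    {r : W → ℕ} {s : U → ℕ} (hr : G.IsEliminationRank (t + 1) r) (hs : X.IsEliminationRank t s)
    (hN : ∀ w, r w < N) :
    (coneGluing G X True).IsEliminationRank (t + 2)
      (Sum.elim (fun o => o.elim 0 fun w => r w + 1) fun p => N + 1 + s p.2) := by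
  set ρ : Option W ⊕ W × U → ℕ :=
    Sum.elim (fun o => o.elim 0 fun w => r w + 1) fun p => N + 1 + s p.2 with hρ
  have h0 : ∀ p, (SimpleGraph.coneGluing G X True).Adj (.inl none) p → 0 < ρ p := by
    rintro ((_ | w) | q) h
    · exact h.elim
    · simp [hρ]
    · simp only [hρ, Sum.elim_inr]; omega
  have hsome : ∀ w, {u | (SimpleGraph.coneGluing G X True).Adj (.inl (some w)) u ∧
      ρ u < ρ (.inl (some w))} ⊆
      insert (.inl none) ((fun v => .inl (some v)) '' {u | G.Adj w u ∧ r u < r w}) := by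
    rintro w ((_ | v) | q) ⟨h, hlt⟩
    · exact .inl rfl
    · refine .inr ⟨v, ⟨h, ?_⟩, rfl⟩
      simpa [hρ] using hlt
    · have := hN w
      simp only [hρ, Sum.elim_inr, Sum.elim_inl, Option.elim] at hlt
      omega
  have hpair : ∀ q, {u | (SimpleGraph.coneGluing G X True).Adj (.inr q) u ∧ ρ u < ρ (.inr q)} ⊆
      insert (.inl none) (insert (.inl (some q.1))
        ((fun v => .inr (q.1, v)) '' {u | X.Adj q.2 u ∧ s u < s q.2})) := by
    rintro ⟨w, u⟩ ((_ | v) | q) ⟨h, hlt⟩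
    · exact .inl rfl
    · exact .inr (.inl (by rw [show v = w from h]))
    · obtain ⟨h1, h2⟩ := h
      refine .inr (.inr ⟨q.2, ⟨h2, ?_⟩, ?_⟩)
      · simpa [hρ] using hlt
      · rw [show w = q.1 from h1]
  have hnone : {u | (SimpleGraph.coneGluing G X True).Adj (.inl none) u ∧
      ρ u < ρ (.inl none)} ⊆ ∅ := by
    rintro u ⟨-, h⟩
    simp [hρ] at h
  refine ⟨?_, ?_, ?_⟩
  · rintro ((_ | v) | p) ((_ | w) | q) h
    · exact h.elim
    · exact (h0 _ h).ne
    · exact (h0 _ h).ne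
    · exact (h0 _ h.symm).ne'
    · simpa [hρ] using hr.ne_of_adj v w h
    · have := hN v
      simp only [hρ, Sum.elim_inr, Sum.elim_inl, Option.elim]; omega
    · exact (h0 _ h.symm).ne'
    · have := hN w
      simp only [hρ, Sum.elim_inr, Sum.elim_inl, Option.elim]; omega
    · simpa [hρ] using hs.ne_of_adj _ _ h.2
  · rintro ((_ | w) | ⟨w, u⟩)
    · exact IsClique.subset hnone isClique_empty
    · refine IsClique.subset (hsome w) ?_
      rw [isClique_insert]
      refine ⟨?_, ?_⟩
      · rintro _ ⟨a, ha, rfl⟩ _ ⟨b, hb, rfl⟩ hab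
        exact hr.isClique w ha hb fun h => hab (h ▸ rfl)
      · rintro _ ⟨a, ha, rfl⟩ -
        exact trivial
    · refine IsClique.subset (hpair _) ?_
      rw [isClique_insert, isClique_insert]
      refine ⟨⟨?_, ?_⟩, ?_⟩
      · rintro _ ⟨a, ha, rfl⟩ _ ⟨b, hb, rfl⟩ hab
        exact ⟨rfl, hs.isClique u ha hb fun h => hab (h ▸ rfl)⟩
      · rintro _ ⟨a, ha, rfl⟩ -
        exact rfl
      · rintro _ (rfl | ⟨a, ha, rfl⟩) -
        · exact trivial
        · exact trivial
  · rintro ((_ | w) | ⟨w, u⟩)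
    · exact (Set.encard_le_encard hnone).trans (by simp)
    · refine (Set.encard_le_encard (hsome w)).trans ((Set.encard_insert_le _ _).trans ?_)
      have := (Set.encard_image_le (fun v => (.inl (some v) : Option W ⊕ W × U)) _).trans
        (hr.encard_le w)
      exact (add_le_add this le_rfl).trans (by norm_cast)
    · refine (Set.encard_le_encard (hpair _)).trans ((Set.encard_insert_le _ _).trans ?_)
      have := (Set.encard_image_le (fun v => (.inr (w, v) : Option W ⊕ W × U)) _).trans
        (hs.encard_le u)
      exact (add_le_add ((Set.encard_insert_le _ _).trans (add_le_add this le_rfl)) le_rfl).trans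
        (by norm_cast)

theorem HasWidthAtMost.coneGluing [Finite W] {G : SimpleGraph W} {X : SimpleGraph U} {t : ℕ}
    (hG : G.HasWidthAtMost (t + 1)) (hX : X.HasWidthAtMost t) (b : Prop) :
    (coneGluing G X b).HasWidthAtMost (t + 2) := by
  obtain ⟨H, hGH, r, hr⟩ := hG
  obtain ⟨Y, hXY, s, hs⟩ := hX
  cases nonempty_fintype W
  exact ⟨_, coneGluing_mono hGH hXY b, _, hr.coneGluing hs fun w =>
    Nat.lt_succ_of_le (Finset.le_sup (f := r) (Finset.mem_univ w))⟩

/-- Here the apex must not be adjacent to `G`: a clique meeting a copy of `X` then has at most one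
vertex outside that copy. -/
theorem card_le_of_isClique_coneGluing {G : SimpleGraph W} {X : SimpleGraph U} {ω : ℕ}
    (hG : ∀ s : Finset W, G.IsClique s → s.card ≤ ω + 1)
    (hX : ∀ s : Finset U, X.IsClique s → s.card ≤ ω) {C : Finset (Option W ⊕ W × U)}
    (hC : (coneGluing G X False).IsClique C) : C.card ≤ ω + 1 := by
  classical
  by_cases hp : ∃ w u, .inr (w, u) ∈ C
  · obtain ⟨w, u, hwu⟩ := hp
    let s : Finset U := C.preimage (fun v => .inr (w, v)) (by intro a _ b _ h; simpa using h)
    have hmem : ∀ (p : Option W ⊕ W × U) (v : U), .inr (w, v) ∈ C →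
        (.inr (w, v) : Option W ⊕ W × U) ∈ insert p (s.image fun v => .inr (w, v)) := fun p v hv =>
      Finset.mem_insert_of_mem (Finset.mem_image.2 ⟨v, Finset.mem_preimage.2 hv, rfl⟩)
    have hs : X.IsClique s := by
      intro a ha b hb hab
      exact (hC (Finset.mem_preimage.1 ha) (Finset.mem_preimage.1 hb) (by simpa using hab)).2
    obtain ⟨p, hp⟩ : ∃ p, C ⊆ insert p (s.image fun v => .inr (w, v)) := by
      by_cases hn : .inl none ∈ C
      · refine ⟨.inl none, ?_⟩
        rintro ((_ | v) | ⟨w', v⟩) hv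
        · simp
        · exact (hC hn hv (by simp)).elim
        · by_cases h : (w', v) = (w, u)
          · obtain ⟨rfl, rfl⟩ := Prod.mk.inj h
            exact hmem _ _ hwu
          · obtain rfl : w' = w := (hC hv hwu (by simpa using h)).1
            exact hmem _ _ hv
      · refine ⟨.inl (some w), ?_⟩
        rintro ((_ | v) | ⟨w', v⟩) hv
        · exact absurd hv hn
        · obtain rfl : v = w := hC hv hwu (by simp)
          simp
        · by_cases h : (w', v) = (w, u)
          · obtain ⟨rfl, rfl⟩ := Prod.mk.inj h
            exact hmem _ _ hwu
          · obtain rfl : w' = w := (hC hv hwu (by simpa using h)).1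
            exact hmem _ _ hv
    calc C.card ≤ _ := Finset.card_le_card hp
      _ ≤ _ := Finset.card_insert_le _ _
      _ ≤ ω + 1 := Nat.succ_le_succ (Finset.card_image_le.trans (hX s hs))
  · push Not at hp
    by_cases hn : .inl none ∈ C
    · refine (Finset.card_le_one.2 fun a ha b hb => ?_).trans (by omega)
      have key : ∀ a ∈ C, a = .inl none := by
        rintro ((_ | v) | ⟨w, u⟩) ha
        · rfl
        · exact (hC hn ha (by simp)).elim
        · exact absurd ha (hp w u)
      rw [key a ha, key b hb]
    · let s : Finset W := C.preimage (fun v => .inl (some v)) (by intro a _ b _ h; simpa using h)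
      have hs : G.IsClique s := by
        intro a ha b hb hab
        exact hC (Finset.mem_preimage.1 ha) (Finset.mem_preimage.1 hb) (by simpa using hab)
      have hCs : C ⊆ s.image fun v => .inl (some v) := by
        rintro ((_ | v) | ⟨w, u⟩) hv
        · exact absurd hv hn
        · exact Finset.mem_image_of_mem _ (Finset.mem_preimage.2 hv)
        · exact absurd hv (hp w u)
      exact (Finset.card_le_card hCs).trans (Finset.card_image_le.trans (hG s hs))

theorem fractionalChromaticNumber_add_two_le_coneGluing [Finite W] [Countable U]
    (G : SimpleGraph W) (X : SimpleGraph U) (b : Prop) :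
    X.fractionalChromaticNumber + 2 ≤
      (coneGluing G X b).fractionalChromaticNumber + 1 / G.fractionalChromaticNumber := by
  rcases isEmpty_or_nonempty W with hW | hW
  · have h0 : G.IsFractionalColoring fun _ => ∅ := ⟨isEmptyElim, isEmptyElim, isEmptyElim⟩
    have : G.fractionalChromaticNumber = 0 := by simpa using fractionalChromaticNumber_le h0
    simp [this]
  rw [fractionalChromaticNumber.eq_1 (coneGluing G X b), ENNReal.iInf_add]
  refine le_iInf fun φ => ?_
  by_cases hφ : (coneGluing G X b).IsFractionalColoring φ
  swap
  · simp [hφ]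
  rw [iInf_pos hφ]
  let f : G →g coneGluing G X b := ⟨fun v => .inl (some v), fun h => h⟩
  set A := φ (.inl none) with hA
  obtain ⟨w, hw⟩ := Finite.exists_min fun w => volume (φ (f w) ∩ A)
  have hm := (hφ.comp f).le_inv_fractionalChromaticNumber (hφ.nullMeasurableSet _)
    (hφ.volume_eq_one _) (measure_ne_top_of_subset Set.inter_subset_right
      (by simp [hA, hφ.volume_eq_one])) hw
  let g : X →g coneGluing G X b := ⟨fun u => .inr (w, u), fun h => ⟨rfl, h⟩⟩
  have hX := fractionalChromaticNumber_le (hφ.comp g)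
  have hdisj : Disjoint (φ (f w) ∪ A) (⋃ u, φ (g u)) := by
    rw [Set.disjoint_iUnion_right]
    intro u
    exact Set.disjoint_union_left.2
      ⟨hφ.disjoint_of_adj _ _ (show w = w from rfl), hφ.disjoint_of_adj _ _ trivial⟩
  have hunion : volume (φ (f w) ∪ A) + volume (⋃ u, φ (g u)) ≤ volume (⋃ v, φ v) := by
    rw [← measure_union₀ (NullMeasurableSet.iUnion fun u => hφ.nullMeasurableSet _)
      hdisj.aedisjoint]
    refine measure_mono (Set.union_subset (Set.union_subset ?_ ?_) (Set.iUnion_subset fun u => ?_))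
    all_goals exact Set.subset_iUnion φ _
  have htwo : volume (φ (f w) ∪ A) + volume (φ (f w) ∩ A) = 2 := by
    rw [measure_union_add_inter₀ _ (hφ.nullMeasurableSet _), hφ.volume_eq_one, hφ.volume_eq_one]
    norm_num
  calc _ ≤ volume (⋃ u, φ (g u)) + (volume (φ (f w) ∪ A) + volume (φ (f w) ∩ A)) := by
        rw [htwo]
        exact add_le_add hX le_rfl
    _ = (volume (φ (f w) ∪ A) + volume (⋃ u, φ (g u))) + volume (φ (f w) ∩ A) := by ring
    _ ≤ _ := add_le_add hunion hm

end ConeGluing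

/-! ### Suprema, exact treewidth and the induction -/

section Extremal

variable {V W : Type*}

theorem cliqueNum_le_iff [Finite V] {G : SimpleGraph V} {ω : ℕ} :
    G.cliqueNum ≤ ω ↔ ∀ s : Finset V, G.IsClique s → s.card ≤ ω := by
  refine ⟨fun h s hs => (IsClique.card_le_cliqueNum (tc := hs)).trans h, fun h => ?_⟩
  obtain ⟨s, hs⟩ := G.exists_isNClique_cliqueNum
  exact hs.card_eq ▸ h s hs.isClique

theorem IsClique.map_embedding {G : SimpleGraph V} {G' : SimpleGraph W} (f : G →g G')
    (hf : Function.Injective f) {s : Finset V} (hs : G.IsClique s) :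
    G'.IsClique (s.map ⟨f, hf⟩ : Finset W) := by
  rintro _ ha _ hb hab
  obtain ⟨a, ha', rfl⟩ := Finset.mem_map.1 (Finset.mem_coe.1 ha)
  obtain ⟨b, hb', rfl⟩ := Finset.mem_map.1 (Finset.mem_coe.1 hb)
  exact f.map_adj (hs ha' hb' fun h => hab (h ▸ rfl))

theorem cliqueNum_le_of_embedding [Finite V] {G : SimpleGraph V} {G' : SimpleGraph W} {ω : ℕ}
    (f : G →g G') (hf : Function.Injective f)
    (h : ∀ s : Finset W, G'.IsClique s → s.card ≤ ω) : G.cliqueNum ≤ ω :=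
  cliqueNum_le_iff.2 fun s hs => by simpa using h _ (hs.map_embedding f hf)

/-- The supremum of `χ_f` over finite graphs of treewidth at most `t` and clique number at most
`ω`. -/
noncomputable def maxFractionalChromaticNumberOfLE (t ω : ℕ) : ℝ≥0∞ :=
  ⨆ (n : ℕ) (G : SimpleGraph (Fin n)) (_ : G.HasWidthAtMost t) (_ : G.cliqueNum ≤ ω),
    G.fractionalChromaticNumber

theorem le_maxFractionalChromaticNumberOfLE [Finite V] {G : SimpleGraph V} {t ω : ℕ}
    (hG : G.HasWidthAtMost t) (hω : ∀ s : Finset V, G.IsClique s → s.card ≤ ω) :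
    G.fractionalChromaticNumber ≤ maxFractionalChromaticNumberOfLE t ω := by
  cases nonempty_fintype V
  let e := G.overFinIso rfl
  exact (fractionalChromaticNumber_mono e.toHom).trans (le_iSup₂_of_le _ (G.overFin rfl)
    (le_iSup₂_of_le (hG.of_isContained e.isContained')
      (cliqueNum_le_of_embedding e.symm.toHom e.symm.injective hω) le_rfl))

theorem le_maxFractionalChromaticNumber [Finite V] {G : SimpleGraph V} {t ω : ℕ}
    (hG : G.HasWidthAtMost t) (hω : ∀ s : Finset V, G.IsClique s → s.card ≤ ω)
    {B : SimpleGraph W} (hB : B ⊑ G) (h : ∀ s, B.HasWidthAtMost s → t ≤ s) :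
    G.fractionalChromaticNumber ≤ maxFractionalChromaticNumber t ω := by
  cases nonempty_fintype V
  let e := G.overFinIso rfl
  exact (fractionalChromaticNumber_mono e.toHom).trans (le_iSup₂_of_le _ (G.overFin rfl)
    (le_iSup₂_of_le (treewidth_eq_of_isContained (hG.of_isContained e.isContained')
      (hB.trans e.isContained) h)
      (cliqueNum_le_of_embedding e.symm.toHom e.symm.injective hω) le_rfl))

theorem maxFractionalChromaticNumber_le (t ω : ℕ) :
    maxFractionalChromaticNumber t ω ≤ (t + 1 : ℕ) := by
  refine iSup₂_le fun n G => iSup₂_le fun ht _ => ?_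
  obtain ⟨c⟩ := (ht ▸ G.hasWidthAtMost_treewidth).colorable
  exact c.fractionalChromaticNumber_le

theorem HasWidthAtMost.sum {G : SimpleGraph V} {G' : SimpleGraph W} {t : ℕ}
    (hG : G.HasWidthAtMost t) (hG' : G'.HasWidthAtMost t) : (G ⊕g G').HasWidthAtMost t := by
  obtain ⟨H, hGH, r, hr⟩ := hG
  obtain ⟨H', hGH', r', hr'⟩ := hG'
  have hinl : ∀ v, {u | (H ⊕g H').Adj (.inl v) u ∧ Sum.elim r r' u < Sum.elim r r' (.inl v)} =
      Sum.inl '' {u | H.Adj v u ∧ r u < r v} := by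
    intro v
    ext (u | u) <;> simp
  have hinr : ∀ v, {u | (H ⊕g H').Adj (.inr v) u ∧ Sum.elim r r' u < Sum.elim r r' (.inr v)} =
      Sum.inr '' {u | H'.Adj v u ∧ r' u < r' v} := by
    intro v
    ext (u | u) <;> simp
  refine ⟨H ⊕g H', ?_, Sum.elim r r', ?_, ?_, ?_⟩
  · rintro (u | u) (v | v) h
    · exact hGH h
    · simp at h
    · simp at h
    · exact hGH' h
  · rintro (u | u) (v | v) h
    · exact hr.ne_of_adj u v h
    · simp at h
    · simp at h
    · exact hr'.ne_of_adj u v h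
  · rintro (v | v)
    · rw [hinl]
      rintro _ ⟨a, ha, rfl⟩ _ ⟨b, hb, rfl⟩ hab
      exact hr.isClique v ha hb fun h => hab (h ▸ rfl)
    · rw [hinr]
      rintro _ ⟨a, ha, rfl⟩ _ ⟨b, hb, rfl⟩ hab
      exact hr'.isClique v ha hb fun h => hab (h ▸ rfl)
  · rintro (v | v)
    · rw [hinl, Sum.inl_injective.encard_image]
      exact hr.encard_le v
    · rw [hinr, Sum.inr_injective.encard_image]
      exact hr'.encard_le v

theorem card_le_of_isClique_sum {G : SimpleGraph V} {G' : SimpleGraph W} {ω : ℕ}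
    (hG : ∀ s : Finset V, G.IsClique s → s.card ≤ ω)
    (hG' : ∀ s : Finset W, G'.IsClique s → s.card ≤ ω) {C : Finset (V ⊕ W)}
    (hC : (G ⊕g G').IsClique C) : C.card ≤ ω := by
  have hl : G.IsClique C.toLeft := fun a ha b hb hab =>
    hC (Finset.mem_toLeft.1 ha) (Finset.mem_toLeft.1 hb) (by simpa using hab)
  have hr : G'.IsClique C.toRight := fun a ha b hb hab =>
    hC (Finset.mem_toRight.1 ha) (Finset.mem_toRight.1 hb) (by simpa using hab)
  rw [← Finset.card_toLeft_add_card_toRight]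
  rcases C.toLeft.eq_empty_or_nonempty with h | ⟨a, ha⟩
  · simpa [h] using hG' _ hr
  rcases C.toRight.eq_empty_or_nonempty with h | ⟨b, hb⟩
  · simpa [h] using hG _ hl
  have := hC (Finset.mem_toLeft.1 ha) (Finset.mem_toRight.1 hb) (by simp)
  simp at this

theorem hasWidthAtMost_completeBipartiteGraph (t : ℕ) (W : Type*) :
    (completeBipartiteGraph (Fin t) W).HasWidthAtMost t := by
  let H : SimpleGraph (Fin t ⊕ W) :=
    { Adj := fun p q => p ≠ q ∧ (p.isLeft ∨ q.isLeft)
      symm := ⟨fun p q h => ⟨h.1.symm, h.2.symm⟩⟩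
      loopless := ⟨fun p h => h.1 rfl⟩ }
  have hsub : ∀ v, {u | H.Adj v u ∧ Sum.elim Fin.val (fun _ => t) u <
      Sum.elim Fin.val (fun _ => t) v} ⊆ Set.range Sum.inl := by
    rintro (v | v) (u | u) ⟨h, hlt⟩
    · simp
    · simp only [Sum.elim_inr, Sum.elim_inl] at hlt
      omega
    · simp
    · simp at hlt
  refine ⟨H, ?_, Sum.elim Fin.val fun _ => t, ?_, fun v => ?_, fun v => ?_⟩
  · rintro (u | u) (v | v) h <;> simp_all [H]
  · rintro (u | u) (v | v) h
    · simpa [H, Fin.val_inj] using h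
    · simpa using u.2.ne
    · simpa using v.2.ne'
    · simp [H] at h
  · refine IsClique.subset (hsub v) ?_
    rintro _ ⟨a, rfl⟩ _ ⟨b, rfl⟩ hab
    exact ⟨hab, .inl rfl⟩
  · refine (Set.encard_le_encard (hsub v)).trans ?_
    rw [← Set.image_univ, Sum.inl_injective.encard_image]
    simp

/-- All `t` neighbors of a vertex of maximal rank have lower rank. -/
theorem le_of_hasWidthAtMost_completeBipartiteGraph {t s : ℕ}
    (h : (completeBipartiteGraph (Fin t) (Fin t)).HasWidthAtMost s) : t ≤ s := by
  rcases t.eq_zero_or_pos with rfl | ht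
  · exact s.zero_le
  obtain ⟨H, hH, r, hr⟩ := h
  have : Nonempty (Fin t ⊕ Fin t) := ⟨.inl ⟨0, ht⟩⟩
  obtain ⟨v, hv⟩ := Finite.exists_max r
  have hlower : ∀ u, (completeBipartiteGraph (Fin t) (Fin t)).Adj v u →
      u ∈ {u | H.Adj v u ∧ r u < r v} := fun u hu =>
    ⟨hH hu, lt_of_le_of_ne (hv u) (hr.ne_of_adj _ _ (hH hu)).symm⟩
  have key : ∀ f : Fin t → Fin t ⊕ Fin t, Function.Injective f →
      (∀ i, (completeBipartiteGraph (Fin t) (Fin t)).Adj v (f i)) → t ≤ s := by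
    intro f hf hadj
    have := (Set.encard_le_encard (show Set.range f ⊆ _ from
      Set.range_subset_iff.2 fun i => hlower _ (hadj i))).trans (hr.encard_le v)
    rw [← Set.image_univ, hf.encard_image] at this
    simpa using this
  rcases v with v | v
  · exact key _ Sum.inr_injective (by simp)
  · exact key _ Sum.inl_injective (by simp)

/-- Adding a disjoint `K_{t,t}` forces treewidth exactly `t` without lowering `χ_f`; its cliques
have at most two vertices. -/
theorem maxFractionalChromaticNumberOfLE_le {t ω : ℕ} (hω : 2 ≤ ω) :
    maxFractionalChromaticNumberOfLE t ω ≤ maxFractionalChromaticNumber t ω := by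
  refine iSup₂_le fun n G => iSup₂_le fun hG hGω => ?_
  refine (fractionalChromaticNumber_mono
    (G' := G ⊕g completeBipartiteGraph (Fin t) (Fin t)) Embedding.sumInl.toHom).trans ?_
  refine le_maxFractionalChromaticNumber
    (hG.sum (hasWidthAtMost_completeBipartiteGraph t (Fin t))) (fun s hs => ?_)
    Embedding.sumInr.isContained fun s => le_of_hasWidthAtMost_completeBipartiteGraph
  refine card_le_of_isClique_sum (cliqueNum_le_iff.1 hGω) (fun s hs => ?_) hs
  exact (hs.card_le_of_coloring (CompleteBipartiteGraph.bicoloring _ _)).trans (by simpa using hω)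

theorem natCast_le_maxFractionalChromaticNumberOfLE {t ω n : ℕ} (ht : n ≤ t + 1) (hω : n ≤ ω) :
    (n : ℝ≥0∞) ≤ maxFractionalChromaticNumberOfLE t ω := by
  refine (natCast_le_fractionalChromaticNumber_top n).trans
    (le_maxFractionalChromaticNumberOfLE ⟨⊤, le_rfl, Fin.val, fun u v h h' => h (Fin.ext h'),
      fun v a _ b _ hab => hab, fun v => ?_⟩ fun s _ => ?_)
  · have hsub : {u | (⊤ : SimpleGraph (Fin n)).Adj v u ∧ u.val < v.val} ⊆
        ((Finset.univ.erase v : Finset (Fin n)) : Set (Fin n)) := by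
      intro u hu
      simpa using hu.1.ne'
    refine (Set.encard_le_encard hsub).trans ?_
    rw [Set.encard_coe_eq_coe_finsetCard, Finset.card_erase_of_mem (Finset.mem_univ v)]
    simp only [Finset.card_univ, Fintype.card_fin]
    exact_mod_cast (by omega : n - 1 ≤ t)
  · exact (Finset.card_le_univ s).trans (by simpa using hω)

theorem maxFractionalChromaticNumberOfLE_add_two_le (t ω : ℕ) :
    maxFractionalChromaticNumberOfLE t ω + 2 ≤
      maxFractionalChromaticNumberOfLE (t + 2) (ω + 1) +
        1 / maxFractionalChromaticNumber (t + 1) (ω + 1) := by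
  simp only [maxFractionalChromaticNumber, one_div, ENNReal.inv_iSup, ENNReal.add_iInf]
  refine le_iInf₂ fun m G => le_iInf₂ fun hG hGω => ?_
  have key : ∀ (n : ℕ) (X : SimpleGraph (Fin n)), X.HasWidthAtMost t → X.cliqueNum ≤ ω →
      X.fractionalChromaticNumber + 2 ≤ maxFractionalChromaticNumberOfLE (t + 2) (ω + 1) +
        G.fractionalChromaticNumber⁻¹ := by
    intro n X hX hXω
    refine (fractionalChromaticNumber_add_two_le_coneGluing G X False).trans ?_
    rw [one_div]
    refine add_le_add (le_maxFractionalChromaticNumberOfLE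
      ((hG ▸ G.hasWidthAtMost_treewidth).coneGluing hX _) fun s hs => ?_) le_rfl
    exact card_le_of_isClique_coneGluing (cliqueNum_le_iff.1 hGω) (cliqueNum_le_iff.1 hXω) hs
  -- The case of empty `X`; it makes subtracting `2` from the right-hand side exact, so the supremum
  -- over `X` can be taken.
  have htwo : 2 ≤ maxFractionalChromaticNumberOfLE (t + 2) (ω + 1) +
      G.fractionalChromaticNumber⁻¹ := by
    refine le_trans le_add_self (key 0 ⊥ ⟨⊥, le_rfl, 0, isEmptyElim, isEmptyElim, isEmptyElim⟩
      (cliqueNum_le_iff.2 fun s _ => ?_))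
    simp [Finset.eq_empty_of_isEmpty s]
  rw [← tsub_add_cancel_of_le htwo]
  refine add_le_add (iSup₂_le fun n X => iSup₂_le fun hX hXω => ?_) le_rfl
  exact ENNReal.le_sub_of_add_le_right (by simp) (key n X hX hXω)

theorem add_one_le_maxFractionalChromaticNumberOfLE_add_sum (k : ℕ) {t ω : ℕ} (hω : 1 ≤ ω)
    (ht : t + 1 = ω + k) (hk : k ≤ ω) :
    (t : ℝ≥0∞) + 1 ≤ maxFractionalChromaticNumberOfLE t ω + ∑ i ∈ Finset.range k,
      1 / maxFractionalChromaticNumber (t + 1 - 2 * (i + 1)) (ω + 1 - (i + 1)) := by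
  induction k generalizing t ω with
  | zero =>
    simpa using natCast_le_maxFractionalChromaticNumberOfLE (n := t + 1) le_rfl (by omega : _ ≤ ω)
  | succ k ih =>
    rcases hω.eq_or_lt with rfl | hω
    -- The recursion would descend to `ω = 0`; instead a single vertex and `f(0, 1) ≤ 1` each
    -- contribute `1`.
    · obtain rfl : k = 0 := by omega
      obtain rfl : t = 1 := by omega
      have h1 := natCast_le_maxFractionalChromaticNumberOfLE (t := 1) (ω := 1) (n := 1)
        (by omega) le_rfl
      have h2 := maxFractionalChromaticNumber_le 0 1
      have h3 : 1 ≤ 1 / maxFractionalChromaticNumber 0 1 := by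
        rw [one_div]
        exact ENNReal.one_le_inv.2 (by simpa using h2)
      simpa using add_le_add h1 h3
    · obtain ⟨ω, rfl⟩ : ∃ ω', ω = ω' + 1 := ⟨ω - 1, by omega⟩
      obtain ⟨t, rfl⟩ : ∃ t', t = t' + 2 := ⟨t - 2, by omega⟩
      have h1 := ih (t := t) (ω := ω) (by omega) (by omega) (by omega)
      have h2 := maxFractionalChromaticNumberOfLE_add_two_le t ω
      -- The term `i = 0` comes from the outermost gluing; the others are those of the smaller case
      -- with shifted index.
      rw [Finset.sum_range_succ']
      have hsum : ∀ i, maxFractionalChromaticNumber (t + 2 + 1 - 2 * (i + 1 + 1))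
          (ω + 1 + 1 - (i + 1 + 1)) =
          maxFractionalChromaticNumber (t + 1 - 2 * (i + 1)) (ω + 1 - (i + 1)) := fun i => by
        congr 1 <;> omega
      simp only [hsum]
      have hfirst : maxFractionalChromaticNumber (t + 2 + 1 - 2 * (0 + 1)) (ω + 1 + 1 - (0 + 1)) =
          maxFractionalChromaticNumber (t + 1) (ω + 1) := by
        congr 1
      rw [hfirst]
      calc ((t + 2 : ℕ) : ℝ≥0∞) + 1 = (t + 1) + 2 := by push_cast; ring
        _ ≤ _ := add_le_add h1 le_rfl
        _ = (maxFractionalChromaticNumberOfLE t ω + 2) + _ := add_right_comm _ _ _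
        _ ≤ _ := add_le_add h2 le_rfl
        _ = _ := by rw [add_assoc, add_comm (1 / _)]

end Extremal

end SimpleGraph

theorem mainTheorem3 (t ω : ℕ) (hω : 2 ≤ ω) (hlow : ((t : ℝ) + 1) / 2 ≤ (ω : ℝ)) (hup : ω ≤ t) :
    SimpleGraph.maxFractionalChromaticNumber t ω < ⊤ ∧
      (t : ℝ≥0∞) + 1 - ∑ i ∈ Finset.Icc 1 (t - ω + 1),
          1 / SimpleGraph.maxFractionalChromaticNumber (t + 1 - 2 * i) (ω + 1 - i)
        ≤ SimpleGraph.maxFractionalChromaticNumber t ω := by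
  refine ⟨(SimpleGraph.maxFractionalChromaticNumber_le t ω).trans_lt (by simp), ?_⟩
  -- This says that the number of steps `t - ω + 1` is at most `ω`, so the clique parameter does not
  -- run out.
  have hlow' : t + 1 ≤ 2 * ω := by
    have : (t : ℝ) + 1 ≤ 2 * ω := by linarith
    exact_mod_cast this
  have hsum : ∀ g : ℕ → ℝ≥0∞, ∑ i ∈ Finset.Icc 1 (t - ω + 1), g i =
      ∑ i ∈ Finset.range (t - ω + 1), g (i + 1) := fun g => by
    rw [Finset.range_eq_Ico, Finset.sum_Ico_add' g 0 (t - ω + 1) 1]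
    rfl
  rw [tsub_le_iff_right, hsum]
  refine (SimpleGraph.add_one_le_maxFractionalChromaticNumberOfLE_add_sum (t - ω + 1) (t := t)
    (ω := ω) (by omega) (by omega) (by omega)).trans ?_
  exact add_le_add (SimpleGraph.maxFractionalChromaticNumberOfLE_le hω) le_rfl
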